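/- For a finite simple graph $G$ let $\mathcal I(G)$ be the set of its independent sets (including the empty set) and let $P_G(\lambda)=\sum_{I\in\mathcal I(G)}\lambda^{|I|}$ be its independence polynomial. Let $H_{3,6}$ be the Heawood graph, i.e. the point-line incidence graph of the Fano plane (it has $14$ vertices). Let $G$ be a finite non-empty cubic ($3$-regular) graph of girth at least $5$. Then for every real $\lambda>0$, \[ \frac{1}{|V(G)|}\log P_G(\lambda)\le\frac1{14}\log P_{H_{3,6}}(\lambda), \] with equality if and only if $G$ is a disjoint union of copies of $H_{3,6}$. In particular, \[ \frac{1}{|V(G)|}\log|\mathcal I(G)|\le\frac1{14}\log|\mathcal I(H_{3,6})|, \] with equality if and only if $G$ is a disjoint union of copies of $H_{3,6}$. -/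

import Mathlib

/-- The independent sets of a finite graph `G` (the empty set included), as a finset of finsets
of vertices. -/
noncomputable def indepSets {V : Type*} [Fintype V] (G : SimpleGraph V) : Finset (Finset V) :=
  open Classical in Finset.univ.filter fun I : Finset V => G.IsIndepSet (I : Set V)

/-- The independence polynomial `P_G`, evaluated at a real number: the sum of `x ^ |I|` over all
independent sets `I` of `G`. -/
noncomputable def indepPoly {V : Type*} [Fintype V] (G : SimpleGraph V) (x : ℝ) : ℝ :=
  ∑ I ∈ indepSets G, x ^ I.card

/-- Incidence in the Fano plane, in its cyclic model: the points and the lines are both indexed by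
`ZMod 7`, and the line with index `l` consists of the points `l`, `l + 1` and `l + 3`. -/
def FanoIncident (p l : ZMod 7) : Prop :=
  p = l ∨ p = l + 1 ∨ p = l + 3

/-- Adjacency in the point-line incidence graph of the Fano plane: `Sum.inl p` is the point `p`,
`Sum.inr l` is the line `l`. -/
def heawoodAdj : ZMod 7 ⊕ ZMod 7 → ZMod 7 ⊕ ZMod 7 → Prop
  | Sum.inl p, Sum.inr l => FanoIncident p l
  | Sum.inr l, Sum.inl p => FanoIncident p l
  | Sum.inl _, Sum.inl _ => False
  | Sum.inr _, Sum.inr _ => False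

/-- The Heawood graph: the point-line incidence graph of the Fano plane. -/
def heawood : SimpleGraph (ZMod 7 ⊕ ZMod 7) where
  Adj := heawoodAdj
  symm := ⟨by rintro (a | a) (b | b) h <;> exact h⟩
  loopless := ⟨by rintro (a | a) h <;> exact h⟩

/-- The disjoint union of `k` copies of a graph `H`. -/
def disjointCopies {W : Type*} (k : ℕ) (H : SimpleGraph W) : SimpleGraph (Fin k × W) where
  Adj a b := a.1 = b.1 ∧ H.Adj a.2 b.2
  symm := ⟨fun _ _ h => ⟨h.1.symm, h.2.symm⟩⟩
  loopless := ⟨fun _ h => H.irrefl h.2⟩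

/-- `G` is a (vertex-disjoint) union of copies of the Heawood graph. -/
def IsUnionOfHeawood {V : Type*} (G : SimpleGraph V) : Prop :=
  ∃ k : ℕ, Nonempty (G ≃g disjointCopies k heawood)

/-!
The proof is by the occupancy method. Fix `x > 0` and weight every independent set `I` of `G` by
`x ^ |I|`. Since `x P_G'(x) / P_G(x)` is the mean size of `I`, and `log P` vanishes at `0`, it is
enough to show that the mean density `x P_G'(x) / (n P_G(x))` is at most that of the Heawood graph,
strictly if `G` is not a union of Heawood graphs (`occupancy_lt`), and to integrate from `0` to `x`
(`log_indepPoly_lt`).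

The density is bounded by linear programming duality. For a vertex `v`, `vertexSlack` is, up to a
positive factor, the density of the Heawood graph minus `[v ∈ I]`, plus a correction
`3 ψ(v) - ∑_{u ~ v} ψ(u)`. Here `ψ(y)` depends only on whether `y` is occupied and on the number of
its occupied neighbours. As `G` is cubic, the corrections cancel when summed over `v`
(`sum_sum_vertexSlack`). So it suffices that the weighted sum of `vertexSlack` over all `I` is
nonnegative for each `v`.

By the girth condition the ball of radius two around `v` has exactly ten vertices: `v`, its
neighbours `u 0, u 1, u 2`, and a group of two further neighbours `w (i, a)` of each `u i`
(`BallLabelling`). Condition on the part `K` of `I` outside the ball. What is left is a *local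
view*: the set of `w`'s without neighbour in `K`, and the edges among them, which form a partial
matching between any two groups. Summing over the states of `v` and the `u i`
(`sum_localSlack`), the
contribution of a view becomes a sum over independent sets `J` of free `w`'s of polynomials in `x`
that depend only on how `J` meets the groups. The weights `dualWeight` solve the complementary
slackness equations for the views that occur in the Heawood graph, and for every view the
resulting polynomial has nonnegative coefficients. This finite statement, together with
information on when the polynomial vanishes, is `viewOk_of_matching`.

If all these sums are zero, then taking `K` empty, respectively a singleton at distance three from
`v`, shows that there are no edges among the `w`'s and that each vertex at distance three is joined
to one vertex in each group (`BallLabelling.Rigid`). This determines the component of `v` as the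
Heawood graph (`BallLabelling.exists_heawood_hom`).
-/

/-! ### Polynomials as coefficient lists -/

/-- The value at `x` of the polynomial with the given list of integer coefficients, constant term
first. -/
def evalCoeffs (x : ℝ) : List ℤ → ℝ
  | [] => 0
  | a :: l => a + x * evalCoeffs x l

/-- Addition of polynomials given by coefficient lists. -/
def addCoeffs : List ℤ → List ℤ → List ℤ
  | [], m => m
  | a :: l, [] => a :: l
  | a :: l, b :: m => (a + b) :: addCoeffs l m

theorem evalCoeffs_addCoeffs (x : ℝ) (l m : List ℤ) :
    evalCoeffs x (addCoeffs l m) = evalCoeffs x l + evalCoeffs x m := by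
  induction l generalizing m with
  | nil => simp [addCoeffs, evalCoeffs]
  | cons a l ih =>
    cases m with
    | nil => simp [addCoeffs, evalCoeffs]
    | cons b m =>
      simp only [addCoeffs, evalCoeffs, ih]
      push_cast
      ring

theorem evalCoeffs_nonneg {x : ℝ} (hx : 0 < x) {l : List ℤ}
    (hl : l.all (fun a => decide (0 ≤ a)) = true) : 0 ≤ evalCoeffs x l := by
  induction l with
  | nil => simp [evalCoeffs]
  | cons a l ih =>
    simp only [List.all_cons, Bool.and_eq_true, decide_eq_true_eq] at hl
    have h1 : (0 : ℝ) ≤ a := by exact_mod_cast hl.1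
    have h2 := ih hl.2
    simp only [evalCoeffs]
    positivity

theorem evalCoeffs_pos {x : ℝ} (hx : 0 < x) {l : List ℤ}
    (hl : l.all (fun a => decide (0 ≤ a)) = true)
    (hl' : l.any (fun a => decide (0 < a)) = true) : 0 < evalCoeffs x l := by
  induction l with
  | nil => simp at hl'
  | cons a l ih =>
    have h2 : 0 ≤ evalCoeffs x l := by
      simp only [List.all_cons, Bool.and_eq_true] at hl
      exact evalCoeffs_nonneg hx hl.2
    simp only [List.all_cons, Bool.and_eq_true, decide_eq_true_eq] at hl
    simp only [List.any_cons, Bool.or_eq_true, decide_eq_true_eq] at hl'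
    have h1 : (0 : ℝ) ≤ a := by exact_mod_cast hl.1
    simp only [evalCoeffs]
    rcases hl' with h | h
    · have : (0 : ℝ) < a := by exact_mod_cast h
      positivity
    · have := ih hl.2 h
      positivity

/-! ### The slack of a local view -/

/-- The contribution to the slack of a set `J` of occupied vertices in the second neighbourhood, as
a coefficient list, when `J` meets `o` of the three groups in one vertex and `t` of them in two.
A common factor `x ^ 5` is removed, and the weight `x ^ |J|` is included. The entries for `J` empty
or a singleton vanish. -/
def slackTable : ℕ → ℕ → List ℤ
  | 0, 1 => [12, 90, 252, 337, 236, 88, 16, 1]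
  | 2, 0 => [0, 3, 20, 41, 30, 11, 2]
  | 1, 1 => [-3, -12, 11, 104, 162, 99, 27, 3]
  | 0, 2 => [0, -6, -24, 19, 188, 283, 168, 43, 4]
  | 3, 0 => [0, -9, -60, -123, -90, -33, -6]
  | 2, 1 => [0, -6, -42, -113, -146, -78, -22, -4]
  | 1, 2 => [0, 0, -12, -75, -166, -169, -66, -11, -2]
  | 0, 3 => [0, 0, 0, -18, -108, -219, -192, -54]
  | _, _ => []

/-- `slackTable` in terms of the numbers `j₀ j₁ j₂ ≤ 2` of occupied vertices in the groups. -/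
def slackCoeffs (j₀ j₁ j₂ : ℕ) : List ℤ :=
  slackTable (j₀ % 2 + j₁ % 2 + j₂ % 2) (j₀ / 2 + j₁ / 2 + j₂ / 2)

/-- The sum of `F b` over the Booleans `b ≤ s`. -/
def sumBelow (s : Bool) (F : Bool → List ℤ) : List ℤ :=
  if s then addCoeffs (F false) (F true) else F false

/-- The slack of a local view: the sum of `slackCoeffs` over the independent sets of free vertices.
The three groups have indicators `s₀ s₀'`, `s₁ s₁'` and `s₂ s₂'` of their free vertices. The edges
are given by `e` between groups `0` and `1`, by `f` between `0` and `2`, and by `g` between `1` and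
`2`, in the order unprimed-unprimed, unprimed-primed, primed-unprimed, primed-primed. -/
def viewCoeffs (s₀ s₀' s₁ s₁' s₂ s₂' : Bool) (e₁ e₂ e₃ e₄ f₁ f₂ f₃ f₄ g₁ g₂ g₃ g₄ : Bool) :
    List ℤ :=
  sumBelow s₀ fun a => sumBelow s₀' fun a' => sumBelow s₁ fun b => sumBelow s₁' fun b' =>
    if (a && b && e₁) || (a && b' && e₂) || (a' && b && e₃) || (a' && b' && e₄) then [] else
    sumBelow s₂ fun c => sumBelow s₂' fun c' =>
    if (a && c && f₁) || (a && c' && f₂) || (a' && c && f₃) || (a' && c' && f₄) ||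
      (b && c && g₁) || (b && c' && g₂) || (b' && c && g₃) || (b' && c' && g₄) then [] else
    slackCoeffs (a.toNat + a'.toNat) (b.toNat + b'.toNat) (c.toNat + c'.toNat)

/-- The edges `e` between the groups with indicators `s s'` and `t t'` join free vertices only and
form a matching. -/
def matchingOk (s s' t t' e₁ e₂ e₃ e₄ : Bool) : Bool :=
  (!e₁ || (s && t)) && (!e₂ || (s && t')) && (!e₃ || (s' && t)) && (!e₄ || (s' && t')) &&
    !(e₁ && e₂) && !(e₃ && e₄) && !(e₁ && e₃) && !(e₂ && e₄)

/-- The certificate for one local view: the slack has nonnegative coefficients, and if it vanishes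
then (1) there are no edges if all six vertices are free, and (2) if there are no edges and no group
is empty, then all six vertices are free or exactly one in each group is. -/
def viewOk (s₀ s₀' s₁ s₁' s₂ s₂' : Bool) (e₁ e₂ e₃ e₄ f₁ f₂ f₃ f₄ g₁ g₂ g₃ g₄ : Bool) : Bool :=
  let p := viewCoeffs s₀ s₀' s₁ s₁' s₂ s₂' e₁ e₂ e₃ e₄ f₁ f₂ f₃ f₄ g₁ g₂ g₃ g₄
  let noEdge := !(e₁ || e₂ || e₃ || e₄ || f₁ || f₂ || f₃ || f₄ || g₁ || g₂ || g₃ || g₄)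
  let full := s₀ && s₀' && s₁ && s₁' && s₂ && s₂'
  p.all (fun a => decide (0 ≤ a)) &&
    (p.any (fun a => decide (0 < a)) ||
      ((!full || noEdge) &&
        (!(noEdge && (s₀ || s₀') && (s₁ || s₁') && (s₂ || s₂')) ||
          full || ((s₀ != s₀') && (s₁ != s₁') && (s₂ != s₂')))))

/-- Edges at vertices that are not free are excluded by `matchingOk`, and the quantifiers are
ordered so that these cases are pruned early: about a thousand views are evaluated. -/
theorem viewOk_of_matching : ∀ s₀ s₀' s₁ s₁' : Bool, ∀ e₁ e₂ e₃ e₄ : Bool,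
    matchingOk s₀ s₀' s₁ s₁' e₁ e₂ e₃ e₄ = true → ∀ s₂ s₂' : Bool, ∀ f₁ f₂ f₃ f₄ : Bool,
    matchingOk s₀ s₀' s₂ s₂' f₁ f₂ f₃ f₄ = true → ∀ g₁ g₂ g₃ g₄ : Bool,
    matchingOk s₁ s₁' s₂ s₂' g₁ g₂ g₃ g₄ = true →
    viewOk s₀ s₀' s₁ s₁' s₂ s₂' e₁ e₂ e₃ e₄ f₁ f₂ f₃ f₄ g₁ g₂ g₃ g₄ = true := by
  decide +kernel

/-! ### The dual weights -/

/-- The independence polynomial of the Heawood graph, explicitly. -/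
def heawoodPoly (x : ℝ) : ℝ :=
  1 + 14 * x + 70 * x ^ 2 + 154 * x ^ 3 + 147 * x ^ 4 + 56 * x ^ 5 + 14 * x ^ 6 + 2 * x ^ 7

/-- The polynomial `x P'(x) / 14`, where `P` is the independence polynomial of the Heawood graph. -/
def heawoodOcc (x : ℝ) : ℝ :=
  x + 10 * x ^ 2 + 33 * x ^ 3 + 42 * x ^ 4 + 20 * x ^ 5 + 6 * x ^ 6 + x ^ 7

/-- The dual variables: the value of the correction `ψ` at an unoccupied vertex with the given
number of occupied neighbours. The value at `1` and the value at an occupied vertex can be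
normalized to
zero; the other three are the solution of the equations saying that the four local views of the
Heawood graph have slack zero, multiplied by `3 (x + 2) P(x)`, where `P` is `heawoodPoly`. -/
def dualWeight (x : ℝ) : ℕ → ℝ
  | 0 => 3 * x ^ 2 + 33 * x ^ 3 + 104 * x ^ 4 + 101 * x ^ 5 + 6 * x ^ 6 - 25 * x ^ 7 - 7 * x ^ 8
  | 2 => -(3 * x + 21 * x ^ 2 + 61 * x ^ 3 + 107 * x ^ 4 + 109 * x ^ 5 + 58 * x ^ 6 + 14 * x ^ 7
      + x ^ 8)
  | 3 => 3 + 24 * x + 73 * x ^ 2 + 99 * x ^ 3 + 25 * x ^ 4 - 63 * x ^ 5 - 55 * x ^ 6 - 15 * x ^ 7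
      - x ^ 8
  | _ => 0

/-- The subset of `Option (Fin 3)` with the given indicators, in the order `none, 0, 1, 2`. -/
def rootSet (b : Bool × Bool × Bool × Bool) : Finset (Option (Fin 3)) :=
  Finset.univ.filter fun o => (o.elim b.1 ![b.2.1, b.2.2.1, b.2.2.2]) = true

theorem rootSet_bijective : Function.Bijective rootSet := by decide +kernel

theorem card_rootSet : ∀ b : Bool × Bool × Bool × Bool,
    (rootSet b).card = b.1.toNat + b.2.1.toNat + b.2.2.1.toNat + b.2.2.2.toNat := by decide +kernel

theorem mem_rootSet : ∀ b : Bool × Bool × Bool × Bool,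
    (none ∈ rootSet b ↔ b.1 = true) ∧ (some 0 ∈ rootSet b ↔ b.2.1 = true) ∧
    (some 1 ∈ rootSet b ↔ b.2.2.1 = true) ∧ (some 2 ∈ rootSet b ↔ b.2.2.2 = true) := by
  decide +kernel

/-- The value of `vertexSlack` in terms of the local configuration: `T` is the set of occupied
vertices among the root (`none`) and its neighbours (`some i`), and `j i` is the number of
occupied vertices
in the `i`-th group of the second neighbourhood. -/
noncomputable def localSlack (x : ℝ) (j : Fin 3 → ℕ) (T : Finset (Option (Fin 3))) : ℝ :=
  3 * (x + 2) * heawoodOcc x - (if none ∈ T then 3 * (x + 2) * heawoodPoly x else 0) +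
    3 * (if none ∈ T then 0 else
      dualWeight x (Finset.univ.filter fun i : Fin 3 => some i ∈ T).card) -
    ∑ i : Fin 3, if some i ∈ T then 0 else dualWeight x ((if none ∈ T then 1 else 0) + j i)

/-- No two occupied vertices are adjacent, where `T` describes the root and its neighbours and at
least one of the two vertices is in `T`. -/
def RootCompat (j : Fin 3 → ℕ) (T : Finset (Option (Fin 3))) : Prop :=
  (none ∈ T → ∀ i, some i ∉ T) ∧ ∀ i, some i ∈ T → j i = 0

open Classical in
/-- Summing out the root and its neighbours turns the slack into `slackCoeffs`. -/
theorem sum_localSlack (x : ℝ) (j : Fin 3 → ℕ) (hj : ∀ i, j i ≤ 2) :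
    x ^ (j 0 + j 1 + j 2) * ∑ T with RootCompat j T, x ^ T.card * localSlack x j T =
      x ^ 5 * evalCoeffs x (slackCoeffs (j 0) (j 1) (j 2)) := by
  have h0 := hj 0
  have h1 := hj 1
  have h2 := hj 2
  rw [Finset.sum_filter, ← Function.Bijective.sum_comp rootSet_bijective]
  simp only [Fintype.sum_prod_type, Fintype.sum_bool, localSlack, RootCompat, Finset.card_filter,
    Fin.sum_univ_three, Fin.forall_fin_succ, Fin.forall_fin_zero, card_rootSet, mem_rootSet,
    Bool.toNat_true, Bool.toNat_false, Fin.succ_zero_eq_one, Fin.succ_one_eq_two]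
  generalize j 0 = p at *
  generalize j 1 = q at *
  generalize j 2 = r at *
  clear hj
  interval_cases p <;> interval_cases q <;> interval_cases r <;>
    (simp [slackCoeffs, slackTable, evalCoeffs, dualWeight, heawoodOcc, heawoodPoly,
      -mul_eq_mul_left_iff, -mul_eq_mul_right_iff, -mul_eq_zero]; try ring)

/-! ### Balls of radius two in cubic graphs of girth at least five -/

section Girth

variable {V : Type*} {G : SimpleGraph V}

theorem not_adj_of_egirth (hgirth : 5 ≤ G.egirth) {a b c : V} (hab : G.Adj a b) (hbc : G.Adj b c) :
    ¬ G.Adj a c := by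
  intro hac
  have := SimpleGraph.le_egirth.1 hgirth a (.cons hab (.cons hbc (.cons hac.symm .nil))) (by
    have := hab.ne; have := hbc.ne; have := hac.ne
    simp [SimpleGraph.Walk.isCycle_def, SimpleGraph.Walk.isTrail_def]
    grind)
  simp at this
  exact absurd this (by decide)

theorem eq_of_adj_of_egirth (hgirth : 5 ≤ G.egirth) {a b c d : V} (hab : G.Adj a b)
    (hbc : G.Adj b c) (had : G.Adj a d) (hdc : G.Adj d c) (hac : a ≠ c) : b = d := by
  by_contra hbd
  have := SimpleGraph.le_egirth.1 hgirth a
    (.cons hab (.cons hbc (.cons hdc.symm (.cons had.symm .nil)))) (by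
    have := hab.ne; have := hbc.ne; have := hdc.ne; have := had.ne
    simp [SimpleGraph.Walk.isCycle_def, SimpleGraph.Walk.isTrail_def]
    grind)
  simp at this
  exact absurd this (by decide)

/-- A labelling of the ball of radius two around `v`: the neighbours of `v` are `u 0, u 1, u 2`,
the neighbours of `u i` other than `v` are `w (i, false)` and `w (i, true)`, and the ten vertices
are distinct. -/
structure BallLabelling (G : SimpleGraph V) (v : V) where
  u : Fin 3 → V
  w : Fin 3 × Bool → V
  adj_root : ∀ x, G.Adj v x ↔ ∃ i, x = u i
  adj_u : ∀ i x, G.Adj (u i) x ↔ x = v ∨ ∃ a, x = w (i, a)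
  u_inj : Function.Injective u
  w_inj : Function.Injective w
  u_ne : ∀ i, u i ≠ v
  w_ne : ∀ p, w p ≠ v
  w_ne_u : ∀ p i, w p ≠ u i

theorem exists_ballLabelling [G.LocallyFinite] (hcubic : G.IsRegularOfDegree 3)
    (hgirth : 5 ≤ G.egirth) (v : V) : Nonempty (BallLabelling G v) := by
  classical
  have hv : (G.neighborFinset v).card = 3 := hcubic v
  let eu := Finset.equivFinOfCardEq hv
  let u : Fin 3 → V := fun i => (eu.symm i : V)
  have u_inj : Function.Injective u := Subtype.val_injective.comp eu.symm.injective
  have adj_root : ∀ x, G.Adj v x ↔ ∃ i, x = u i := by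
    intro x
    constructor
    · intro h
      exact ⟨eu ⟨x, by simpa using h⟩, by simp [u]⟩
    · rintro ⟨i, rfl⟩
      exact (G.mem_neighborFinset _ _).1 (eu.symm i).2
  have hvu : ∀ i, G.Adj v (u i) := fun i => (adj_root _).2 ⟨i, rfl⟩
  have hw : ∀ i, ∃ p : V × V, p.1 ≠ p.2 ∧ (G.neighborFinset (u i)).erase v = {p.1, p.2} := by
    intro i
    have h3 : (G.neighborFinset (u i)).card = 3 := hcubic (u i)
    have : ((G.neighborFinset (u i)).erase v).card = 2 := by
      rw [Finset.card_erase_of_mem (by simpa using (hvu i).symm), h3]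
    obtain ⟨a, b, hab, h⟩ := Finset.card_eq_two.1 this
    exact ⟨(a, b), hab, h⟩
  choose p hp1 hp2 using hw
  let w : Fin 3 × Bool → V := fun q => if q.2 then (p q.1).1 else (p q.1).2
  have hmem : ∀ i x, (x ≠ v ∧ G.Adj (u i) x) ↔ ∃ a, x = w (i, a) := by
    intro i x
    have : x ∈ (G.neighborFinset (u i)).erase v ↔ x ∈ ({(p i).1, (p i).2} : Finset V) := by
      rw [hp2]
    simp only [Finset.mem_erase, SimpleGraph.mem_neighborFinset, Finset.mem_insert,
      Finset.mem_singleton] at this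
    rw [this, Bool.exists_bool]
    simp [w, or_comm]
  have huw : ∀ q, w q ≠ v ∧ G.Adj (u q.1) (w q) := fun q => (hmem q.1 _).2 ⟨q.2, rfl⟩
  refine ⟨⟨u, w, adj_root, ?_, u_inj, ?_, fun i => (hvu i).ne', fun q => (huw q).1, ?_⟩⟩
  · intro i x
    rw [← hmem]
    have := (hvu i).symm
    by_cases hx : x = v
    · simp [hx, this]
    · simp [hx]
  · rintro ⟨i, a⟩ ⟨k, b⟩ h
    have h1 := huw (i, a)
    have h2 := huw (k, b)
    rw [← h] at h2
    obtain rfl : i = k := u_inj (eq_of_adj_of_egirth hgirth (hvu i) h1.2 (hvu k) h2.2 h1.1.symm)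
    have := hp1 i
    rw [ne_eq, eq_comm] at this
    cases a <;> cases b <;> simp_all [w]
  · intro q i h
    exact not_adj_of_egirth hgirth (hvu q.1) (huw q).2 (h ▸ hvu i)

namespace BallLabelling

variable {v : V}

theorem adj_v_u (B : BallLabelling G v) (i : Fin 3) : G.Adj v (B.u i) := (B.adj_root _).2 ⟨i, rfl⟩

theorem adj_u_w (B : BallLabelling G v) (p : Fin 3 × Bool) : G.Adj (B.u p.1) (B.w p) :=
  (B.adj_u _ _).2 (.inr ⟨p.2, rfl⟩)

end BallLabelling

end Girth

/-! ### Conditioning on the outside of a ball -/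

section Local

open Classical in
/-- A subset of `V` is a subset of the range of `e` together with a subset of its complement. -/
theorem sum_finset_eq_sum_map_union {α V : Type*} [Fintype α] [Fintype V] (e : α ↪ V)
    (g : Finset V → ℝ) :
    ∑ I, g I = ∑ K ∈ (Finset.univ.map e)ᶜ.powerset, ∑ T : Finset α, g (T.map e ∪ K) := by
  rw [← Finset.sum_product']
  refine Finset.sum_nbij' (fun I => (I \ Finset.univ.map e, Finset.univ.filter fun a => e a ∈ I))
    (fun p => p.2.map e ∪ p.1) ?_ ?_ ?_ ?_ ?_
  · intro I _
    simp [Finset.subset_iff]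
  · simp
  · intro I _
    ext y
    simp only [Finset.mem_union, Finset.mem_map, Finset.mem_filter, Finset.mem_univ, true_and,
      Finset.mem_sdiff]
    grind
  · rintro ⟨K, T⟩ h
    simp only [Finset.mem_product, Finset.mem_powerset, Finset.subset_iff, Finset.mem_compl,
      Finset.mem_map, Finset.mem_univ, true_and, and_true] at h
    ext y
    · simp only [Finset.mem_union, Finset.mem_map, Finset.mem_univ, true_and,
        Finset.mem_sdiff]
      grind
    · simp only [Finset.mem_union, Finset.mem_map, Finset.mem_filter, Finset.mem_univ, true_and,
        EmbeddingLike.apply_eq_iff_eq, exists_eq_right]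
      grind
  · intro I _
    congr 1
    ext y
    simp only [Finset.mem_union, Finset.mem_map, Finset.mem_filter, Finset.mem_univ, true_and,
      Finset.mem_sdiff]
    grind

variable {V : Type*} {G : SimpleGraph V} {v : V}

open Classical in
/-- The correction `ψ(y)`, see `dualWeight`. -/
noncomputable def vertexDual (G : SimpleGraph V) (x : ℝ) (I : Finset V) (y : V) : ℝ :=
  if y ∈ I then 0 else dualWeight x (I.filter fun z => G.Adj y z).card

open Classical in
/-- The slack at `v` of the independent set `I`: the difference between the density of the Heawood
graph and `[v ∈ I]`, times `3 (x + 2) P(x)`, plus a correction that cancels in the sum over `v`. -/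
noncomputable def vertexSlack [Fintype V] (G : SimpleGraph V) (x : ℝ) (v : V) (I : Finset V) : ℝ :=
  3 * (x + 2) * heawoodOcc x - (if v ∈ I then 3 * (x + 2) * heawoodPoly x else 0) +
    3 * vertexDual G x I v - ∑ u with G.Adj v u, vertexDual G x I u

/-- The number of elements of `J` in the `i`-th group. -/
def groupCount (J : Finset (Fin 3 × Bool)) (i : Fin 3) : ℕ :=
  (J.filter fun p => p.1 = i).card

theorem groupCount_le (J : Finset (Fin 3 × Bool)) (i : Fin 3) : groupCount J i ≤ 2 := by
  refine (Finset.card_le_card (Finset.filter_subset_filter _ (Finset.subset_univ J))).trans ?_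
  revert i
  decide

theorem groupCount_eq_zero {J : Finset (Fin 3 × Bool)} {i : Fin 3} :
    groupCount J i = 0 ↔ ∀ a, (i, a) ∉ J := by
  simp only [groupCount, Finset.card_eq_zero, Finset.filter_eq_empty_iff, Prod.forall]
  grind

theorem sum_groupCount (J : Finset (Fin 3 × Bool)) :
    groupCount J 0 + groupCount J 1 + groupCount J 2 = J.card := by
  rw [← Fin.sum_univ_three]
  exact (Finset.card_eq_sum_card_fiberwise fun _ _ => Finset.mem_univ _).symm

theorem isIndepSet_coe_iff {I : Finset V} :
    G.IsIndepSet (I : Set V) ↔ ∀ a ∈ I, ∀ b ∈ I, ¬ G.Adj a b := by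
  constructor
  · intro h a ha b hb hab
    exact h ha hb hab.ne hab
  · intro h a ha b hb _
    exact h a ha b hb

namespace BallLabelling

/-- The labels of the ten vertices of the ball: `inl none` is the centre, `inl (some i)` its
neighbour `u i`, and `inr (i, a)` the vertex `w (i, a)`. -/
def emb (B : BallLabelling G v) : Option (Fin 3) ⊕ (Fin 3 × Bool) ↪ V where
  toFun := Sum.elim (fun o => o.elim v B.u) B.w
  inj' := by
    have h1 := B.u_inj
    have h2 := B.w_inj
    have h3 := B.u_ne
    have h4 := B.w_ne
    have h5 := B.w_ne_u
    rintro ((_ | i) | p) ((_ | k) | q) h <;> simp at h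
    · rfl
    · exact absurd h.symm (h3 _)
    · exact absurd h.symm (h4 _)
    · exact absurd h (h3 _)
    · rw [h1 h]
    · exact absurd h.symm (h5 _ _)
    · exact absurd h (h4 _)
    · exact absurd h (h5 _ _)
    · rw [h2 h]

@[simp] theorem emb_none (B : BallLabelling G v) : B.emb (.inl none) = v := rfl
@[simp] theorem emb_some (B : BallLabelling G v) (i : Fin 3) : B.emb (.inl (some i)) = B.u i := rfl
@[simp] theorem emb_inr (B : BallLabelling G v) (p : Fin 3 × Bool) : B.emb (.inr p) = B.w p := rfl

/-- The vertices of the ball, as a finset. -/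
def ball (B : BallLabelling G v) : Finset V := Finset.univ.map B.emb

open Classical in
/-- The set consisting of `K` and of the vertices of the ball with labels in `T` and `J`. -/
noncomputable def assemble (B : BallLabelling G v) (K : Finset V) (T : Finset (Option (Fin 3)))
    (J : Finset (Fin 3 × Bool)) : Finset V :=
  (T.disjSum J).map B.emb ∪ K

theorem mem_assemble (B : BallLabelling G v) {K : Finset V} {T : Finset (Option (Fin 3))}
    {J : Finset (Fin 3 × Bool)} {y : V} :
    y ∈ B.assemble K T J ↔
      (none ∈ T ∧ y = v ∨ (∃ i, some i ∈ T ∧ y = B.u i) ∨ ∃ p ∈ J, y = B.w p) ∨ y ∈ K := by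
  classical
  simp only [assemble, Finset.mem_union, Finset.mem_map, Sum.exists, Option.exists,
    Finset.inl_mem_disjSum, Finset.inr_mem_disjSum, emb_none, emb_some, emb_inr, @eq_comm _ y,
    or_assoc]

theorem mem_ball (B : BallLabelling G v) {y : V} :
    y ∈ B.ball ↔ y = v ∨ (∃ i, y = B.u i) ∨ ∃ p, y = B.w p := by
  simp only [ball, Finset.mem_map, Sum.exists, Option.exists, Finset.mem_univ, true_and,
    emb_none, emb_some, emb_inr, @eq_comm _ y, or_assoc]

theorem card_assemble (B : BallLabelling G v) {K : Finset V} (hK : Disjoint K B.ball)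
    (T : Finset (Option (Fin 3))) (J : Finset (Fin 3 × Bool)) :
    (B.assemble K T J).card = T.card + J.card + K.card := by
  classical
  rw [assemble, Finset.card_union_of_disjoint, Finset.card_map, Finset.card_disjSum]
  exact (hK.mono_right (Finset.map_subset_map.2 (Finset.subset_univ _))).symm

variable (B : BallLabelling G v) {K : Finset V} {T : Finset (Option (Fin 3))}
    {J : Finset (Fin 3 × Bool)}

theorem root_mem_assemble (hK : Disjoint K B.ball) : v ∈ B.assemble K T J ↔ none ∈ T := by
  have : v ∉ K := fun h => Finset.disjoint_left.1 hK h (B.mem_ball.2 (.inl rfl))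
  rw [mem_assemble]
  have h1 := B.u_ne
  have h2 := B.w_ne
  grind

theorem u_mem_assemble (hK : Disjoint K B.ball) {i : Fin 3} :
    B.u i ∈ B.assemble K T J ↔ some i ∈ T := by
  have : B.u i ∉ K := fun h => Finset.disjoint_left.1 hK h (B.mem_ball.2 (.inr (.inl ⟨i, rfl⟩)))
  rw [mem_assemble]
  have h1 := B.u_ne
  have h2 := B.w_ne_u
  have h3 : ∀ k, B.u i = B.u k ↔ i = k := fun k => B.u_inj.eq_iff
  simp only [h1, h3, this]
  grind

theorem w_mem_assemble (hK : Disjoint K B.ball) {p : Fin 3 × Bool} :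
    B.w p ∈ B.assemble K T J ↔ p ∈ J := by
  have : B.w p ∉ K := fun h => Finset.disjoint_left.1 hK h (B.mem_ball.2 (.inr (.inr ⟨p, rfl⟩)))
  rw [mem_assemble]
  have h1 := B.w_ne
  have h2 := B.w_ne_u
  have h3 : ∀ q, B.w p = B.w q ↔ p = q := fun q => B.w_inj.eq_iff
  simp only [h1, h3, this]
  grind

/-- The vertices of the second neighbourhood with labels in `J` are pairwise nonadjacent and have no
neighbour in `K`. -/
def Free (B : BallLabelling G v) (K : Finset V) (J : Finset (Fin 3 × Bool)) : Prop :=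
  (∀ p ∈ J, ∀ k ∈ K, ¬ G.Adj (B.w p) k) ∧ ∀ p ∈ J, ∀ q ∈ J, ¬ G.Adj (B.w p) (B.w q)

theorem isIndepSet_assemble (hK : Disjoint K B.ball) :
    G.IsIndepSet (B.assemble K T J : Set V) ↔
      G.IsIndepSet (K : Set V) ∧ B.Free K J ∧ RootCompat (groupCount J) T := by
  have hk : ∀ k ∈ K, k ∉ B.ball := fun k h => Finset.disjoint_left.1 hK h
  have hvk : ∀ k ∈ K, ¬ G.Adj v k := fun k h hv =>
    hk k h (B.mem_ball.2 (.inr (.inl ((B.adj_root k).1 hv))))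
  have huk : ∀ i, ∀ k ∈ K, ¬ G.Adj (B.u i) k := fun i k h hv => by
    rcases (B.adj_u i k).1 hv with rfl | ⟨a, rfl⟩
    · exact hk _ h (B.mem_ball.2 (.inl rfl))
    · exact hk _ h (B.mem_ball.2 (.inr (.inr ⟨_, rfl⟩)))
  rw [isIndepSet_coe_iff, isIndepSet_coe_iff]
  constructor
  · intro h
    refine ⟨fun a ha b hb => h a (B.mem_assemble.2 (.inr ha)) b (B.mem_assemble.2 (.inr hb)),
      ⟨fun p hp k hk => h _ ((B.w_mem_assemble hK).2 hp) _ (B.mem_assemble.2 (.inr hk)),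
      fun p hp q hq => h _ ((B.w_mem_assemble hK).2 hp) _ ((B.w_mem_assemble hK).2 hq)⟩,
      fun hT i hi => h _ ((B.root_mem_assemble hK).2 hT) _ ((B.u_mem_assemble hK).2 hi)
        (B.adj_v_u i), fun i hi => groupCount_eq_zero.2 fun a ha =>
        h _ ((B.u_mem_assemble hK).2 hi) _ ((B.w_mem_assemble hK).2 ha) (B.adj_u_w (i, a))⟩
  · rintro ⟨h1, ⟨h2, h3⟩, h4, h5⟩
    have hvu : none ∈ T → ∀ b ∈ B.assemble K T J, ¬ G.Adj v b := by
      intro hT b hb hvb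
      obtain ⟨i, rfl⟩ := (B.adj_root b).1 hvb
      exact h4 hT i ((B.u_mem_assemble hK).1 hb)
    have huw : ∀ i, some i ∈ T → ∀ b ∈ B.assemble K T J, ¬ G.Adj (B.u i) b := by
      intro i hi b hb hub
      rcases (B.adj_u i b).1 hub with rfl | ⟨a, rfl⟩
      · exact h4 ((B.root_mem_assemble hK).1 hb) i hi
      · exact groupCount_eq_zero.1 (h5 i hi) a ((B.w_mem_assemble hK).1 hb)
    intro a ha b hb hab
    rcases B.mem_assemble.1 ha with (⟨hT, rfl⟩ | ⟨i, hi, rfl⟩ | ⟨p, hp, rfl⟩) | ha'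
    · exact hvu hT b hb hab
    · exact huw i hi b hb hab
    · rcases B.mem_assemble.1 hb with (⟨hT, rfl⟩ | ⟨i, hi, rfl⟩ | ⟨q, hq, rfl⟩) | hb'
      · exact hvu hT _ ha hab.symm
      · exact huw i hi _ ha hab.symm
      · exact h3 p hp q hq hab
      · exact h2 p hp b hb' hab
    · rcases B.mem_assemble.1 hb with (⟨hT, rfl⟩ | ⟨i, hi, rfl⟩ | ⟨q, hq, rfl⟩) | hb'
      · exact hvu hT _ ha hab.symm
      · exact huw i hi _ ha hab.symm
      · exact h2 q hq a ha' hab.symm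
      · exact h1 a ha' b hb' hab

theorem vertexSlack_assemble [Fintype V] (hK : Disjoint K B.ball) (x : ℝ) :
    vertexSlack G x v (B.assemble K T J) = localSlack x (groupCount J) T := by
  classical
  have h1 : ((B.assemble K T J).filter fun z => G.Adj v z).card =
      (Finset.univ.filter fun i : Fin 3 => some i ∈ T).card := by
    rw [← Finset.card_map ⟨B.u, B.u_inj⟩]
    congr 1
    ext z
    simp only [Finset.mem_filter, Finset.mem_map, Finset.mem_univ, true_and,
      Function.Embedding.coeFn_mk, B.adj_root]
    constructor
    · rintro ⟨h, i, rfl⟩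
      exact ⟨i, (B.u_mem_assemble hK).1 h, rfl⟩
    · rintro ⟨i, h, rfl⟩
      exact ⟨(B.u_mem_assemble hK).2 h, i, rfl⟩
  have h2 : ∀ i, ((B.assemble K T J).filter fun z => G.Adj (B.u i) z).card =
      (if none ∈ T then 1 else 0) + groupCount J i := by
    intro i
    have : ((B.assemble K T J).filter fun z => G.Adj (B.u i) z) =
        (if none ∈ T then {v} else ∅) ∪ (J.filter fun p => p.1 = i).map ⟨B.w, B.w_inj⟩ := by
      ext z
      simp only [Finset.mem_filter, Finset.mem_union, Finset.mem_map,
        Function.Embedding.coeFn_mk, B.adj_u]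
      constructor
      · rintro ⟨h, rfl | ⟨a, rfl⟩⟩
        · simp [(B.root_mem_assemble hK).1 h]
        · exact .inr ⟨_, ⟨(B.w_mem_assemble hK).1 h, rfl⟩, rfl⟩
      · rintro (h | ⟨⟨k, a⟩, ⟨h, rfl⟩, rfl⟩)
        · split_ifs at h with hT
          · obtain rfl := Finset.mem_singleton.1 h
            exact ⟨(B.root_mem_assemble hK).2 hT, .inl rfl⟩
          · simp at h
        · exact ⟨(B.w_mem_assemble hK).2 h, .inr ⟨a, rfl⟩⟩
    rw [this, Finset.card_union_of_disjoint, Finset.card_map, groupCount]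
    · congr 1
      split_ifs <;> simp
    · rw [Finset.disjoint_left]
      intro z hz hz'
      obtain ⟨p, _, rfl⟩ := Finset.mem_map.1 hz'
      split_ifs at hz
      · exact B.w_ne p (Finset.mem_singleton.1 hz)
      · simp at hz
  have h3 : (Finset.univ.filter fun y => G.Adj v y) = Finset.univ.map ⟨B.u, B.u_inj⟩ := by
    ext z
    simp [B.adj_root, @eq_comm _ z]
  rw [vertexSlack, localSlack, h3, Finset.sum_map]
  simp only [vertexDual, Function.Embedding.coeFn_mk, B.root_mem_assemble hK,
    B.u_mem_assemble hK, h1, h2]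

open Classical in
/-- The weighted sum of the slack at `v`, split according to the part `K` outside the ball and the
part `J` in the second neighbourhood. -/
theorem sum_vertexSlack [Fintype V] (x : ℝ) :
    ∑ I ∈ indepSets G, x ^ I.card * vertexSlack G x v I =
      x ^ 5 * ∑ K ∈ B.ballᶜ.powerset.filter (fun K : Finset V => G.IsIndepSet (K : Set V)),
        x ^ K.card *
        ∑ J with B.Free K J,
          evalCoeffs x (slackCoeffs (groupCount J 0) (groupCount J 1) (groupCount J 2)) := by
  rw [indepSets, Finset.sum_filter, sum_finset_eq_sum_map_union B.emb, Finset.sum_filter,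
    Finset.mul_sum]
  refine Finset.sum_congr rfl fun K hK => ?_
  have hK' : Disjoint K B.ball := by
    rw [Finset.mem_powerset] at hK
    exact Finset.disjoint_left.2 fun k hk => Finset.mem_compl.1 (hK hk)
  rw [← Finset.sumEquiv.symm.toEquiv.sum_comp, Fintype.sum_prod_type_right]
  have key : ∀ (J : Finset (Fin 3 × Bool)) (T : Finset (Option (Fin 3))),
      (if G.IsIndepSet (((Finset.sumEquiv.symm.toEquiv (T, J)).map B.emb ∪ K : Finset V) : Set V)
        then x ^ ((Finset.sumEquiv.symm.toEquiv (T, J)).map B.emb ∪ K).card *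
          vertexSlack G x v ((Finset.sumEquiv.symm.toEquiv (T, J)).map B.emb ∪ K) else 0) =
      if G.IsIndepSet (K : Set V) then (if B.Free K J then x ^ K.card * (x ^ J.card *
        (if RootCompat (groupCount J) T then
          x ^ T.card * localSlack x (groupCount J) T else 0)) else 0) else 0 := by
    intro J T
    change (if G.IsIndepSet (B.assemble K T J : Set V) then x ^ (B.assemble K T J).card *
      vertexSlack G x v (B.assemble K T J) else 0) = _
    rw [B.vertexSlack_assemble hK', B.card_assemble hK']
    simp only [B.isIndepSet_assemble hK', ite_and]
    split_ifs <;> ring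
  simp only [key]
  split_ifs with hi
  · rw [Finset.sum_filter, Finset.mul_sum, Finset.mul_sum]
    refine Finset.sum_congr rfl fun J _ => ?_
    split_ifs with hJ
    · rw [← Finset.mul_sum, ← Finset.mul_sum, ← Finset.sum_filter, ← sum_groupCount,
        sum_localSlack x _ (groupCount_le J)]
      ring
    · simp
  · simp

end BallLabelling

end Local

/-! ### Nonnegativity of the slack and the case of equality -/

/-- The subset of `Fin 3 × Bool` with the given indicators, in lexicographic order. -/
def outerSet (b : Bool × Bool × Bool × Bool × Bool × Bool) : Finset (Fin 3 × Bool) :=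
  Finset.univ.filter fun p =>
    (![cond p.2 b.2.1 b.1, cond p.2 b.2.2.2.1 b.2.2.1, cond p.2 b.2.2.2.2.2 b.2.2.2.2.1] p.1) = true

theorem outerSet_bijective : Function.Bijective outerSet := by decide +kernel

theorem groupCount_outerSet : ∀ b : Bool × Bool × Bool × Bool × Bool × Bool,
    groupCount (outerSet b) 0 = b.1.toNat + b.2.1.toNat ∧
    groupCount (outerSet b) 1 = b.2.2.1.toNat + b.2.2.2.1.toNat ∧
    groupCount (outerSet b) 2 = b.2.2.2.2.1.toNat + b.2.2.2.2.2.toNat := by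
  decide +kernel

theorem mem_outerSet : ∀ b : Bool × Bool × Bool × Bool × Bool × Bool,
    ((0, false) ∈ outerSet b ↔ b.1 = true) ∧ ((0, true) ∈ outerSet b ↔ b.2.1 = true) ∧
    ((1, false) ∈ outerSet b ↔ b.2.2.1 = true) ∧ ((1, true) ∈ outerSet b ↔ b.2.2.2.1 = true) ∧
    ((2, false) ∈ outerSet b ↔ b.2.2.2.2.1 = true) ∧
    ((2, true) ∈ outerSet b ↔ b.2.2.2.2.2 = true) := by
  decide +kernel

theorem evalCoeffs_sumBelow (x : ℝ) (s : Bool) (F : Bool → List ℤ) :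
    evalCoeffs x (sumBelow s F) =
      ∑ b : Bool, if b = true → s = true then evalCoeffs x (F b) else 0 := by
  cases s <;> simp [sumBelow, evalCoeffs_addCoeffs, add_comm]

theorem evalCoeffs_ite (x : ℝ) (c : Prop) [Decidable c] (l : List ℤ) :
    evalCoeffs x (if c then [] else l) = if c then 0 else evalCoeffs x l := by
  split_ifs <;> rfl

/-- `viewCoeffs` for the local view with free vertices `s` and edges `e`. -/
def viewSlack (s : Fin 3 × Bool → Bool) (e : Fin 3 × Bool → Fin 3 × Bool → Bool) : List ℤ :=
  viewCoeffs (s (0, false)) (s (0, true)) (s (1, false)) (s (1, true)) (s (2, false)) (s (2, true))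
    (e (0, false) (1, false)) (e (0, false) (1, true)) (e (0, true) (1, false))
    (e (0, true) (1, true))
    (e (0, false) (2, false)) (e (0, false) (2, true)) (e (0, true) (2, false))
    (e (0, true) (2, true))
    (e (1, false) (2, false)) (e (1, false) (2, true)) (e (1, true) (2, false))
    (e (1, true) (2, true))

open Classical in
theorem sum_eq_evalCoeffs_viewSlack (x : ℝ) (s : Fin 3 × Bool → Bool)
    (e : Fin 3 × Bool → Fin 3 × Bool → Bool) (hsymm : ∀ p q, e p q = e q p)
    (hgroup : ∀ i a b, e (i, a) (i, b) = false) :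
    ∑ J with (∀ p ∈ J, s p = true) ∧ ∀ p ∈ J, ∀ q ∈ J, e p q = false,
      evalCoeffs x (slackCoeffs (groupCount J 0) (groupCount J 1) (groupCount J 2)) =
    evalCoeffs x (viewSlack s e) := by
  have pull : ∀ (c : Prop) [Decidable c] (f : Bool → ℝ),
      (if c then ∑ b, f b else 0) = ∑ b, if c then f b else 0 := by
    intros; split_ifs <;> simp
  have pull' : ∀ (c : Prop) [Decidable c] (f : Bool → ℝ),
      (if c then 0 else ∑ b, f b) = ∑ b, if c then 0 else f b := by
    intros; split_ifs <;> simp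
  rw [Finset.sum_filter, ← Function.Bijective.sum_comp outerSet_bijective]
  simp only [viewSlack, viewCoeffs, evalCoeffs_sumBelow, evalCoeffs_ite, pull, pull',
    Fintype.sum_prod_type]
  refine Finset.sum_congr rfl fun a _ => Finset.sum_congr rfl fun a' _ =>
    Finset.sum_congr rfl fun b _ => Finset.sum_congr rfl fun b' _ =>
    Finset.sum_congr rfl fun c _ => Finset.sum_congr rfl fun c' _ => ?_
  have h1 := groupCount_outerSet (a, a', b, b', c, c')
  have h2 := mem_outerSet (a, a', b, b', c, c')
  simp only at h1 h2
  simp only [h1, Prod.forall, Fin.forall_fin_succ, Fin.forall_fin_zero, Bool.forall_bool,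
    Fin.succ_zero_eq_one, Fin.succ_one_eq_two, h2, hgroup,
    hsymm (1, _) (0, _), hsymm (2, _) (0, _), hsymm (2, _) (1, _)]
  generalize evalCoeffs x _ = g
  clear h1 h2 hsymm hgroup pull pull'
  have flip : ∀ (c : Prop) [Decidable c] (y : ℝ),
      (if c then 0 else y) = if ¬ c then y else 0 := by
    intros; split_ifs <;> rfl
  simp only [flip, ← ite_and, Bool.or_eq_true, Bool.and_eq_true, not_or, not_and, Bool.not_eq_true]
  refine if_congr ?_ rfl rfl
  simp only [and_imp]
  grind (splits := 40)

theorem viewSlack_spec {s : Fin 3 × Bool → Bool} {e : Fin 3 × Bool → Fin 3 × Bool → Bool}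
    (hsymm : ∀ p q, e p q = e q p) (hgroup : ∀ i a b, e (i, a) (i, b) = false)
    (hsupp : ∀ p q, e p q = true → s p = true ∧ s q = true)
    (hmatch : ∀ p i, ¬ (e p (i, false) = true ∧ e p (i, true) = true)) :
    (viewSlack s e).all (fun a => decide (0 ≤ a)) = true ∧
    ((viewSlack s e).any (fun a => decide (0 < a)) = true ∨
      ((∀ p, s p = true) → ∀ p q, e p q = false) ∧
      ((∀ p q, e p q = false) → (∀ i, ∃ a, s (i, a) = true) →
        (∀ p, s p = true) ∨ ∀ i, s (i, false) ≠ s (i, true))) := by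
  have hm : ∀ i k, matchingOk (s (i, false)) (s (i, true)) (s (k, false)) (s (k, true))
      (e (i, false) (k, false)) (e (i, false) (k, true)) (e (i, true) (k, false))
      (e (i, true) (k, true)) = true := by
    intro i k
    have h1 := hsupp (i, false) (k, false)
    have h2 := hsupp (i, false) (k, true)
    have h3 := hsupp (i, true) (k, false)
    have h4 := hsupp (i, true) (k, true)
    have h5 := hmatch (i, false) k
    have h6 := hmatch (i, true) k
    have h7 := hmatch (k, false) i
    have h8 := hmatch (k, true) i
    rw [hsymm (k, _), hsymm (k, _)] at h7 h8
    clear hsupp hmatch hsymm hgroup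
    simp only [matchingOk, Bool.and_eq_true, Bool.or_eq_true, Bool.not_eq_true', ← Bool.not_eq_true]
    grind
  have h := viewOk_of_matching _ _ _ _ _ _ _ _ (hm 0 1) _ _ _ _ _ _ (hm 0 2) _ _ _ _ (hm 1 2)
  simp only [viewOk, Bool.and_eq_true] at h
  refine ⟨h.1, ?_⟩
  have h2 := h.2
  rw [Bool.or_eq_true] at h2
  refine h2.imp id fun h3 => ?_
  clear h2 h hm hmatch hsupp
  simp only [Prod.forall, Fin.forall_fin_succ, Fin.forall_fin_zero, Bool.forall_bool,
    Fin.succ_zero_eq_one, Fin.succ_one_eq_two, hgroup, Bool.exists_bool,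
    hsymm (1, _) (0, _), hsymm (2, _) (0, _), hsymm (2, _) (1, _)]
  clear hsymm hgroup
  grind (splits := 60)

namespace BallLabelling

variable {V : Type*} {G : SimpleGraph V} {v : V}

open Classical in
/-- The vertex `w p` has no neighbour in `K`. -/
noncomputable def freeVertex (B : BallLabelling G v) (K : Finset V) (p : Fin 3 × Bool) : Bool :=
  decide (∀ k ∈ K, ¬ G.Adj (B.w p) k)

open Classical in
/-- The edges between the free vertices. Edges at other vertices are left out, as `matchingOk`
requires. -/
noncomputable def freeEdge (B : BallLabelling G v) (K : Finset V) (p q : Fin 3 × Bool) : Bool :=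
  decide (G.Adj (B.w p) (B.w q)) && B.freeVertex K p && B.freeVertex K q

theorem free_iff (B : BallLabelling G v) (K : Finset V) (J : Finset (Fin 3 × Bool)) :
    B.Free K J ↔ (∀ p ∈ J, B.freeVertex K p = true) ∧
      ∀ p ∈ J, ∀ q ∈ J, B.freeEdge K p q = false := by
  have h : ∀ p, B.freeVertex K p = true ↔ ∀ k ∈ K, ¬ G.Adj (B.w p) k := fun p => by
    simp [freeVertex]
  simp only [Free, ← h]
  refine and_congr_right fun hs => forall₂_congr fun p hp => forall₂_congr fun q hq => ?_
  simp [freeEdge, hs p hp, hs q hq]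

theorem freeEdge_comm (B : BallLabelling G v) (K : Finset V) (p q : Fin 3 × Bool) :
    B.freeEdge K p q = B.freeEdge K q p := by
  rw [Bool.eq_iff_iff]
  simp only [freeEdge, G.adj_comm (B.w p), Bool.and_eq_true, decide_eq_true_eq]
  tauto

theorem not_adj_w_same (B : BallLabelling G v) (hgirth : 5 ≤ G.egirth) (i : Fin 3) (a b : Bool) :
    ¬ G.Adj (B.w (i, a)) (B.w (i, b)) :=
  not_adj_of_egirth hgirth (B.adj_u_w (i, a)).symm (B.adj_u_w (i, b))

/-- A vertex other than `u i` has at most one neighbour in the `i`-th group. -/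
theorem not_adj_both (B : BallLabelling G v) (hgirth : 5 ≤ G.egirth) {x : V} {i : Fin 3}
    (hx : x ≠ B.u i) {a b : Bool} (ha : G.Adj x (B.w (i, a))) (hb : G.Adj x (B.w (i, b))) :
    a = b := by
  have := B.w_inj (eq_of_adj_of_egirth hgirth ha (B.adj_u_w (i, a)).symm hb
    (B.adj_u_w (i, b)).symm hx)
  grind

theorem viewSlack_free (B : BallLabelling G v) (hgirth : 5 ≤ G.egirth) (K : Finset V) :
    (viewSlack (B.freeVertex K) (B.freeEdge K)).all (fun a => decide (0 ≤ a)) = true ∧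
    ((viewSlack (B.freeVertex K) (B.freeEdge K)).any (fun a => decide (0 < a)) = true ∨
      ((∀ p, B.freeVertex K p = true) → ∀ p q, B.freeEdge K p q = false) ∧
      ((∀ p q, B.freeEdge K p q = false) → (∀ i, ∃ a, B.freeVertex K (i, a) = true) →
        (∀ p, B.freeVertex K p = true) ∨
          ∀ i, B.freeVertex K (i, false) ≠ B.freeVertex K (i, true))) := by
  refine viewSlack_spec ?_ ?_ ?_ ?_
  · exact B.freeEdge_comm K
  · intro i a b
    simp [freeEdge, B.not_adj_w_same hgirth]
  · intro p q
    simp only [freeEdge]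
    grind
  · rintro p i ⟨h1, h2⟩
    simp only [freeEdge, Bool.and_eq_true, decide_eq_true_eq] at h1 h2
    have := B.not_adj_both hgirth (B.w_ne_u p i) h1.1.1 h2.1.1
    simp at this

open Classical in
theorem sum_vertexSlack_eq [Fintype V] (B : BallLabelling G v) (hgirth : 5 ≤ G.egirth) (x : ℝ) :
    ∑ I ∈ indepSets G, x ^ I.card * vertexSlack G x v I =
      x ^ 5 * ∑ K ∈ B.ballᶜ.powerset.filter (fun K : Finset V => G.IsIndepSet (K : Set V)),
        x ^ K.card * evalCoeffs x (viewSlack (B.freeVertex K) (B.freeEdge K)) := by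
  rw [B.sum_vertexSlack]
  congr 1
  refine Finset.sum_congr rfl fun K _ => ?_
  congr 1
  rw [← sum_eq_evalCoeffs_viewSlack]
  · simp only [B.free_iff]
  · exact B.freeEdge_comm K
  · intro i a b
    simp [freeEdge, B.not_adj_w_same hgirth]

/-- The conclusion in the case of equality: the second neighbourhood is an independent set, and
every vertex outside the ball that is adjacent to it is adjacent to some vertex in each group. -/
def Rigid (B : BallLabelling G v) : Prop :=
  (∀ p q, ¬ G.Adj (B.w p) (B.w q)) ∧
    ∀ x, x ∉ B.ball → (∃ p, G.Adj (B.w p) x) → ∀ i, ∃ a, G.Adj (B.w (i, a)) x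

theorem sum_vertexSlack_nonneg [Fintype V] (B : BallLabelling G v) (hgirth : 5 ≤ G.egirth)
    {x : ℝ} (hx : 0 < x) : 0 ≤ ∑ I ∈ indepSets G, x ^ I.card * vertexSlack G x v I := by
  classical
  rw [B.sum_vertexSlack_eq hgirth]
  have := fun K => evalCoeffs_nonneg hx (B.viewSlack_free hgirth K).1
  exact mul_nonneg (by positivity)
    (Finset.sum_nonneg fun K _ => mul_nonneg (by positivity) (this K))

/-- If the slack at `v` sums to zero, every local view that occurs has slack zero. The view of
`K = ∅` gives the first half of `Rigid`, the view of a single vertex outside the ball the second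
half. -/
theorem rigid_of_sum_vertexSlack_eq_zero [Fintype V] (B : BallLabelling G v)
    (hgirth : 5 ≤ G.egirth) {x : ℝ} (hx : 0 < x)
    (h : ∑ I ∈ indepSets G, x ^ I.card * vertexSlack G x v I = 0) : B.Rigid := by
  classical
  have hn := fun K => evalCoeffs_nonneg hx (B.viewSlack_free hgirth K).1
  rw [B.sum_vertexSlack_eq hgirth, mul_eq_zero, or_iff_right (by positivity),
    Finset.sum_eq_zero_iff_of_nonneg fun K _ => mul_nonneg (by positivity) (hn K)] at h
  have key : ∀ K : Finset V, K ⊆ B.ballᶜ → G.IsIndepSet (K : Set V) →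
      ((∀ p, B.freeVertex K p = true) → ∀ p q, B.freeEdge K p q = false) ∧
      ((∀ p q, B.freeEdge K p q = false) → (∀ i, ∃ a, B.freeVertex K (i, a) = true) →
        (∀ p, B.freeVertex K p = true) ∨
          ∀ i, B.freeVertex K (i, false) ≠ B.freeVertex K (i, true)) := by
    intro K hK hi
    have h1 := h K (Finset.mem_filter.2 ⟨Finset.mem_powerset.2 hK, hi⟩)
    rw [mul_eq_zero, or_iff_right (by positivity)] at h1
    obtain ⟨h2, h3 | h3⟩ := B.viewSlack_free hgirth K
    · exact absurd h1 (evalCoeffs_pos hx h2 h3).ne'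
    · exact h3
  have h0 : ∀ p q, ¬ G.Adj (B.w p) (B.w q) := by
    intro p q hpq
    have := (key ∅ (by simp) (by simp)).1 (by simp [freeVertex]) p q
    simp [freeEdge, freeVertex, hpq] at this
  refine ⟨h0, fun y hy hp i => ?_⟩
  have hyu : ∀ i, y ≠ B.u i := fun i hi => hy (B.mem_ball.2 (.inr (.inl ⟨i, hi⟩)))
  have h1 := (key {y} (by simpa using hy) (by simp [SimpleGraph.isIndepSet_iff])).2
    (by simp [freeEdge, h0])
    (by
      intro i
      by_contra! hc
      simp only [freeVertex, Finset.mem_singleton, forall_eq, decide_eq_true_eq, not_not,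
        ne_eq] at hc
      have := B.not_adj_both hgirth (hyu i) (hc false).symm (hc true).symm
      simp at this)
  simp only [freeVertex, Finset.mem_singleton, forall_eq, decide_eq_true_eq] at h1
  rcases h1 with h1 | h1
  · obtain ⟨p, hp⟩ := hp
    exact absurd hp (h1 p)
  · by_contra! hc
    have := h1 i
    simp [hc] at this

end BallLabelling

/-! ### Rigid balls span Heawood graphs -/

section Heawood

variable {V : Type*} {G : SimpleGraph V} {v : V}

theorem BallLabelling.exists_outer_pair [G.LocallyFinite] (hcubic : G.IsRegularOfDegree 3)
    (B : BallLabelling G v) (hB : B.Rigid) (p : Fin 3 × Bool) :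
    ∃ y z, y ≠ z ∧ y ∉ B.ball ∧ z ∉ B.ball ∧ G.Adj (B.w p) y ∧ G.Adj (B.w p) z := by
  classical
  have h3 : (G.neighborFinset (B.w p)).card = 3 := hcubic _
  have : ((G.neighborFinset (B.w p)).erase (B.u p.1)).card = 2 := by
    rw [Finset.card_erase_of_mem (by simpa using (B.adj_u_w p).symm), h3]
  obtain ⟨y, z, hyz, h⟩ := Finset.card_eq_two.1 this
  have key : ∀ t ∈ (G.neighborFinset (B.w p)).erase (B.u p.1), t ∉ B.ball ∧ G.Adj (B.w p) t := by
    intro t ht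
    rw [Finset.mem_erase, SimpleGraph.mem_neighborFinset] at ht
    refine ⟨fun hb => ?_, ht.2⟩
    rcases B.mem_ball.1 hb with rfl | ⟨i, rfl⟩ | ⟨q, rfl⟩
    · obtain ⟨i, hi⟩ := (B.adj_root _).1 ht.2.symm
      exact B.w_ne_u p i hi
    · rcases (B.adj_u i _).1 ht.2.symm with h | ⟨a, h⟩
      · exact B.w_ne p h
      · exact ht.1 (by rw [B.w_inj h])
    · exact hB.1 p q ht.2
  rw [h] at key
  have hy := key y (by simp)
  have hz := key z (by simp)
  exact ⟨y, z, hyz, hy.1, hz.1, hy.2, hz.2⟩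

/-- The two outer neighbours of `w (0, false)` and those of `w (0, true)` are four distinct
vertices. Since two of them have at most one common neighbour, their neighbours in the groups
`1` and `2` are
determined up to the labelling, and together with the ball they form a copy of the Heawood graph. -/
theorem BallLabelling.exists_heawood_hom [G.LocallyFinite] (hcubic : G.IsRegularOfDegree 3)
    (hgirth : 5 ≤ G.egirth) (B : BallLabelling G v) (hB : B.Rigid) :
    ∃ f : ZMod 7 ⊕ ZMod 7 → V, Function.Injective f ∧
      (∀ a b, heawood.Adj a b → G.Adj (f a) (f b)) ∧ ∃ a, f a = v := by
  have hxu : ∀ x, x ∉ B.ball → ∀ i, x ≠ B.u i := fun x hx i hi =>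
    hx (B.mem_ball.2 (.inr (.inl ⟨i, hi⟩)))
  -- Two outer vertices have at most one common neighbour.
  have hshare : ∀ {x y p q}, x ≠ y → G.Adj (B.w p) x → G.Adj (B.w p) y → G.Adj (B.w q) x →
      G.Adj (B.w q) y → p = q := fun hxy h1 h2 h3 h4 =>
    B.w_inj (eq_of_adj_of_egirth hgirth h1.symm h2 h3.symm h4 hxy)
  have hswitch : ∀ {x y p i a}, x ≠ y → y ∉ B.ball → G.Adj (B.w p) x → G.Adj (B.w p) y →
      G.Adj (B.w (i, a)) x → p.1 ≠ i → G.Adj (B.w (i, !a)) y := by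
    intro x y p i a hxy hy h1 h2 h3 hpi
    obtain ⟨b, hb⟩ := hB.2 y hy ⟨p, h2⟩ i
    have : b ≠ a := by
      rintro rfl
      exact hpi (by rw [hshare hxy h1 h2 h3 hb])
    rwa [← Bool.eq_not.2 this]
  -- The lines of `heawood` with indices `1, 5, 2, 3` are `x₁, x₂, x₃, x₄`. The labels `a` and `b`
  -- are those of the neighbours of `x₁`, and `x₃` is chosen to share the neighbour `w (1, a)`
  -- with it.
  obtain ⟨x₁, x₂, h12, hx₁, hx₂, h₁, h₂⟩ := B.exists_outer_pair hcubic hB (0, false)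
  have hpair : ∀ a, ∃ x₃ x₄, x₃ ≠ x₄ ∧ x₃ ∉ B.ball ∧ x₄ ∉ B.ball ∧ G.Adj (B.w (0, true)) x₃ ∧
      G.Adj (B.w (0, true)) x₄ ∧ G.Adj (B.w (1, a)) x₃ := by
    intro a
    obtain ⟨y, z, hyz, hy, hz, h1, h2⟩ := B.exists_outer_pair hcubic hB (0, true)
    obtain ⟨b, hb⟩ := hB.2 y hy ⟨_, h1⟩ 1
    by_cases hab : b = a
    · subst hab
      exact ⟨y, z, hyz, hy, hz, h1, h2, hb⟩
    · have := hswitch hyz hz h1 h2 hb (by decide)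
      rw [Bool.eq_not.2 hab, Bool.not_not] at this
      exact ⟨z, y, hyz.symm, hz, hy, h2, h1, this⟩
  obtain ⟨a, h₁a⟩ := hB.2 x₁ hx₁ ⟨_, h₁⟩ 1
  obtain ⟨b, h₁b⟩ := hB.2 x₁ hx₁ ⟨_, h₁⟩ 2
  have h₂a := hswitch h12 hx₂ h₁ h₂ h₁a (by decide)
  have h₂b := hswitch h12 hx₂ h₁ h₂ h₁b (by decide)
  obtain ⟨x₃, x₄, h34, hx₃, hx₄, h₃, h₄, h₃a⟩ := hpair a
  have hdiff : ∀ {x y}, x ∉ B.ball → G.Adj (B.w (0, false)) x → G.Adj (B.w (0, true)) y →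
      x ≠ y := by
    rintro x y hx h1 h2 rfl
    have := B.not_adj_both hgirth (hxu x hx 0) h1.symm h2.symm
    simp at this
  have h13 := hdiff hx₁ h₁ h₃
  have h14 := hdiff hx₁ h₁ h₄
  have h23 := hdiff hx₂ h₂ h₃
  have h24 := hdiff hx₂ h₂ h₄
  have h₃b := hswitch h13 hx₃ h₁a h₃a h₁b (show (1 : Fin 3) ≠ 2 by decide)
  have h₄a := hswitch h34 hx₄ h₃ h₄ h₃a (by decide)
  have h₄b := hswitch h34 hx₄ h₃ h₄ h₃b (by decide)
  rw [Bool.not_not] at h₄b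
  let idx : Fin 7 → Option (Fin 3) ⊕ (Fin 3 × Bool) := ![.inl none, .inr (0, false), .inr (1, a),
    .inr (0, true), .inr (2, b), .inr (2, !b), .inr (1, !a)]
  have hidx : Function.Injective idx := by
    simp only [idx]
    clear * -
    revert a b
    decide +kernel
  let P : Fin 7 → V := fun i => B.emb (idx i)
  let L : Fin 7 → V := ![B.u 0, x₁, x₃, x₄, B.u 2, x₂, B.u 1]
  have hPL : ∀ l : Fin 7,
      G.Adj (P l) (L l) ∧ G.Adj (P (l + 1)) (L l) ∧ G.Adj (P (l + 3)) (L l) := by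
    have e1 := B.adj_v_u
    have e2 := fun p => (B.adj_u_w p).symm
    intro l
    fin_cases l
    · exact ⟨e1 0, e2 (0, false), e2 (0, true)⟩
    · exact ⟨h₁, h₁a, h₁b⟩
    · exact ⟨h₃a, h₃, h₃b⟩
    · exact ⟨h₄, h₄b, h₄a⟩
    · exact ⟨e2 (2, b), e2 (2, !b), e1 2⟩
    · exact ⟨h₂b, h₂a, h₂⟩
    · exact ⟨e2 (1, !a), e1 1, e2 (1, a)⟩
  have hPL' : ∀ p l : ZMod 7, FanoIncident p l → G.Adj (P p) (L l) := by
    rintro p l (rfl | rfl | rfl)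
    exacts [(hPL p).1, (hPL l).2.1, (hPL l).2.2]
  have hL : Function.Injective L := by
    have u01 : B.u 0 ≠ B.u 1 := B.u_inj.ne (by decide)
    have u02 : B.u 0 ≠ B.u 2 := B.u_inj.ne (by decide)
    have u12 : B.u 1 ≠ B.u 2 := B.u_inj.ne (by decide)
    have k1 := hxu x₁ hx₁
    have k2 := hxu x₂ hx₂
    have k3 := hxu x₃ hx₃
    have k4 := hxu x₄ hx₄
    rw [← List.nodup_ofFn]
    simp only [L, List.ofFn_succ, List.ofFn_zero, List.nodup_cons, List.mem_cons, List.not_mem_nil]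
    simp [h12, h13, h14, h34, u01, u02, k1, k2, k3, k4, h23.symm, h24.symm, u12.symm,
      (k1 _).symm, (k2 _).symm, (k3 _).symm, (k4 _).symm]
  have hne : ∀ p l, P p ≠ L l := by
    have hP : ∀ p, P p = v ∨ ∃ q, P p = B.w q := by
      intro p
      fin_cases p
      · exact .inl rfl
      all_goals exact .inr ⟨_, rfl⟩
    have hL' : ∀ l, (∃ i, L l = B.u i) ∨ L l ∉ B.ball := by
      intro l
      fin_cases l
      exacts [.inl ⟨0, rfl⟩, .inr hx₁, .inr hx₃, .inr hx₄, .inl ⟨2, rfl⟩, .inr hx₂, .inl ⟨1, rfl⟩]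
    intro p l h
    rcases hL' l with ⟨i, hi⟩ | hl
    · rcases hP p with hp | ⟨q, hq⟩
      · exact B.u_ne i (by rw [← hi, ← h, hp])
      · exact B.w_ne_u q i (by rw [← hi, ← h, hq])
    · rcases hP p with hp | ⟨q, hq⟩
      · exact hl (B.mem_ball.2 (.inl (by rw [← h, hp])))
      · exact hl (B.mem_ball.2 (.inr (.inr ⟨q, by rw [← h, hq]⟩)))
  refine ⟨Sum.elim P L, (B.emb.injective.comp hidx).sumElim hL hne, ?_, .inl 0, rfl⟩
  rintro (p | l) (q | m) h
  · exact h.elim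
  · exact hPL' p m h
  · exact (hPL' q l h).symm
  · exact h.elim

instance : DecidableRel heawood.Adj
  | .inl p, .inr l => inferInstanceAs (Decidable (p = l ∨ p = l + 1 ∨ p = l + 3))
  | .inr l, .inl p => inferInstanceAs (Decidable (p = l ∨ p = l + 1 ∨ p = l + 3))
  | .inl _, .inl _ => inferInstanceAs (Decidable False)
  | .inr _, .inr _ => inferInstanceAs (Decidable False)

theorem heawood_preconnected : heawood.Preconnected := by
  have h : ∀ a b, ∃ c d, (a = c ∨ heawood.Adj a c) ∧ (c = d ∨ heawood.Adj c d) ∧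
      (d = b ∨ heawood.Adj d b) := by decide +kernel
  have h' : ∀ {a b}, (a = b ∨ heawood.Adj a b) → heawood.Reachable a b := by
    rintro a b (rfl | h)
    exacts [.refl _, h.reachable]
  intro a b
  obtain ⟨c, d, h1, h2, h3⟩ := h a b
  exact ((h' h1).trans (h' h2)).trans (h' h3)

theorem heawood_card_adj : ∀ a, (Finset.univ.filter fun b => heawood.Adj a b).card = 3 := by
  decide +kernel

/-- An injective homomorphism between cubic graphs is surjective on neighbourhoods. -/
theorem exists_adj_of_heawood_hom [G.LocallyFinite] (hcubic : G.IsRegularOfDegree 3)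
    {f : ZMod 7 ⊕ ZMod 7 → V} (hf : Function.Injective f)
    (hadj : ∀ a b, heawood.Adj a b → G.Adj (f a) (f b)) {a : ZMod 7 ⊕ ZMod 7} {y : V}
    (h : G.Adj (f a) y) : ∃ b, heawood.Adj a b ∧ f b = y := by
  have h1 : (Finset.univ.filter fun b => heawood.Adj a b).map ⟨f, hf⟩ = G.neighborFinset (f a) := by
    refine Finset.eq_of_subset_of_card_le ?_ ?_
    · intro z hz
      simp only [Finset.mem_map, Finset.mem_filter, Finset.mem_univ, true_and,
        Function.Embedding.coeFn_mk] at hz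
      obtain ⟨b, hb, rfl⟩ := hz
      simpa using hadj a b hb
    · rw [Finset.card_map, heawood_card_adj]
      exact (hcubic (f a)).le
  have h2 : y ∈ G.neighborFinset (f a) := by simpa using h
  rw [← h1] at h2
  simpa using h2

theorem isUnionOfHeawood_of_exists_hom [Fintype V] [G.LocallyFinite]
    (hcubic : G.IsRegularOfDegree 3)
    (h : ∀ v, ∃ f : ZMod 7 ⊕ ZMod 7 → V, Function.Injective f ∧
      (∀ a b, heawood.Adj a b → G.Adj (f a) (f b)) ∧ ∃ a, f a = v) :
    IsUnionOfHeawood G := by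
  classical
  choose f hinj hadj r hr using fun c : G.ConnectedComponent => h c.out
  have hreach : ∀ c a b, G.Reachable (f c a) (f c b) := fun c a b =>
    (heawood_preconnected a b).map ⟨f c, fun h => hadj c _ _ h⟩
  have hcomp : ∀ c a, G.connectedComponentMk (f c a) = c := by
    intro c a
    have := hreach c a (r c)
    rw [hr] at this
    exact (SimpleGraph.ConnectedComponent.sound this).trans (Quot.out_eq c)
  have hsurj : ∀ y, ∃ a, f (G.connectedComponentMk y) a = y := by
    intro y
    set c := G.connectedComponentMk y with hc
    have h1 : ∀ z, G.Reachable (f c (r c)) z → ∃ a, f c a = z := by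
      rintro z ⟨p⟩
      suffices ∀ {s t : V} (p : G.Walk s t), (∃ a, f c a = s) → ∃ a, f c a = t from this p ⟨_, rfl⟩
      intro s t p
      induction p with
      | nil => exact id
      | cons hst _ ih =>
        rintro ⟨a, rfl⟩
        obtain ⟨b, _, hb⟩ := exists_adj_of_heawood_hom hcubic (hinj c) (hadj c) hst
        exact ih ⟨b, hb⟩
    refine h1 y (SimpleGraph.ConnectedComponent.exact ?_)
    rw [hcomp]
  let F : G.ConnectedComponent × (ZMod 7 ⊕ ZMod 7) → V := fun p => f p.1 p.2
  have hF : Function.Bijective F := by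
    constructor
    · rintro ⟨c, a⟩ ⟨d, b⟩ hab
      have : c = d := by rw [← hcomp c a, ← hcomp d b]; exact congrArg _ hab
      subst this
      exact congrArg _ (hinj c hab)
    · intro y
      obtain ⟨a, ha⟩ := hsurj y
      exact ⟨(_, a), ha⟩
  have hFadj : ∀ p q, G.Adj (F p) (F q) ↔ p.1 = q.1 ∧ heawood.Adj p.2 q.2 := by
    rintro ⟨c, a⟩ ⟨d, b⟩
    constructor
    · intro hab
      have : c = d := by
        rw [← hcomp c a, ← hcomp d b]
        exact SimpleGraph.ConnectedComponent.sound hab.reachable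
      subst this
      obtain ⟨b', hb', hbb⟩ := exists_adj_of_heawood_hom hcubic (hinj c) (hadj c) hab
      rw [hinj c hbb] at hb'
      exact ⟨rfl, hb'⟩
    · rintro ⟨rfl, hab⟩
      exact hadj c _ _ hab
  have : Finite G.ConnectedComponent := Quot.finite _
  obtain ⟨k, ⟨eqv⟩⟩ := Finite.exists_equiv_fin G.ConnectedComponent
  refine ⟨k, ⟨RelIso.symm ⟨(eqv.symm.prodCongr (Equiv.refl _)).trans (Equiv.ofBijective F hF), ?_⟩⟩⟩
  intro p q
  simp [hFadj, disjointCopies]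

end Heawood

/-! ### Independence polynomials -/

section Global

variable {V : Type*} [Fintype V] {G : SimpleGraph V}

open Classical in
theorem sum_sum_adj [G.LocallyFinite] (hcubic : G.IsRegularOfDegree 3) (g : V → ℝ) :
    ∑ v, ∑ u with G.Adj v u, g u = 3 * ∑ u, g u := by
  simp only [Finset.sum_filter]
  rw [Finset.sum_comm, Finset.mul_sum]
  refine Finset.sum_congr rfl fun u _ => ?_
  rw [← Finset.sum_filter, Finset.sum_const, nsmul_eq_mul]
  congr 1
  have : (Finset.univ.filter fun v => G.Adj v u) = G.neighborFinset u := by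
    ext v
    simp [G.adj_comm]
  rw [this]
  exact_mod_cast hcubic u

theorem sum_sum_vertexSlack [G.LocallyFinite] (hcubic : G.IsRegularOfDegree 3) (x : ℝ) :
    ∑ v, ∑ I ∈ indepSets G, x ^ I.card * vertexSlack G x v I =
      3 * (x + 2) * (Fintype.card V * heawoodOcc x * indepPoly G x -
        heawoodPoly x * ∑ I ∈ indepSets G, I.card * x ^ I.card) := by
  classical
  have h : ∀ I : Finset V, ∑ v, vertexSlack G x v I =
      3 * (x + 2) * (Fintype.card V * heawoodOcc x - heawoodPoly x * I.card) := by
    intro I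
    simp only [vertexSlack, Finset.sum_sub_distrib, Finset.sum_add_distrib]
    rw [sum_sum_adj hcubic, ← Finset.mul_sum Finset.univ (vertexDual G x I) 3, ← Finset.sum_filter]
    simp
    ring
  rw [Finset.sum_comm]
  simp only [← Finset.mul_sum, h]
  rw [indepPoly, Finset.mul_sum, Finset.mul_sum, ← Finset.sum_sub_distrib, Finset.mul_sum]
  refine Finset.sum_congr rfl fun I _ => ?_
  ring

theorem indepPoly_pos (G : SimpleGraph V) {x : ℝ} (hx : 0 ≤ x) : 0 < indepPoly G x := by
  classical
  have : (∅ : Finset V) ∈ indepSets G := by simp [indepSets]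
  refine lt_of_lt_of_le ?_ (Finset.single_le_sum (f := fun I : Finset V => x ^ I.card)
    (fun I _ => by positivity) this)
  simp

theorem indepPoly_zero (G : SimpleGraph V) : indepPoly G 0 = 1 := by
  classical
  have : (∅ : Finset V) ∈ indepSets G := by simp [indepSets]
  rw [indepPoly, Finset.sum_eq_single_of_mem _ this]
  · simp
  · intro I _ hI
    simp [hI]

theorem indepPoly_one (G : SimpleGraph V) : indepPoly G 1 = (indepSets G).card := by
  simp [indepPoly]

theorem hasDerivAt_indepPoly (G : SimpleGraph V) (x : ℝ) :
    HasDerivAt (indepPoly G) (∑ I ∈ indepSets G, I.card * x ^ (I.card - 1)) x := by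
  unfold indepPoly
  exact HasDerivAt.fun_sum fun I _ => hasDerivAt_pow _ _

theorem mul_deriv_indepPoly (G : SimpleGraph V) (x : ℝ) :
    x * ∑ I ∈ indepSets G, (I.card : ℝ) * x ^ (I.card - 1) =
      ∑ I ∈ indepSets G, I.card * x ^ I.card := by
  rw [Finset.mul_sum]
  refine Finset.sum_congr rfl fun I _ => ?_
  rcases Nat.eq_zero_or_pos I.card with h | h
  · simp [h]
  · rw [← Nat.sub_add_cancel h, pow_succ, Nat.add_sub_cancel]
    ring

theorem indepPoly_congr {W : Type*} [Fintype W] {H : SimpleGraph W} (f : G ≃g H) (x : ℝ) :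
    indepPoly G x = indepPoly H x := by
  classical
  refine Finset.sum_bij' (fun I _ => I.map f.toEquiv.toEmbedding)
    (fun J _ => J.map f.symm.toEquiv.toEmbedding) ?_ ?_ ?_ ?_ ?_
  · intro I hI
    simp only [indepSets, Finset.mem_filter, Finset.mem_univ, true_and,
      isIndepSet_coe_iff, Finset.mem_map_equiv] at hI ⊢
    exact fun a ha b hb hab => hI _ ha _ hb (f.symm.map_adj_iff.2 hab)
  · intro I hI
    simp only [indepSets, Finset.mem_filter, Finset.mem_univ, true_and,
      isIndepSet_coe_iff, Finset.mem_map_equiv] at hI ⊢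
    exact fun a ha b hb hab => hI _ ha _ hb (f.map_adj_iff.2 hab)
  · intro I _
    ext a
    simp only [Finset.mem_map_equiv]
    exact iff_of_eq (congrArg (· ∈ I) (f.symm_apply_apply a))
  · intro I _
    ext a
    simp only [Finset.mem_map_equiv]
    exact iff_of_eq (congrArg (· ∈ I) (f.apply_symm_apply a))
  · simp

theorem indepPoly_disjointCopies {W : Type*} [Fintype W] (H : SimpleGraph W) (k : ℕ) (x : ℝ) :
    indepPoly (disjointCopies k H) x = indepPoly H x ^ k := by
  classical
  have h := Finset.prod_univ_sum (fun _ : Fin k => indepSets H) (fun _ I => x ^ I.card)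
  rw [Finset.prod_const, Finset.card_univ, Fintype.card_fin] at h
  rw [indepPoly, indepPoly, h]
  symm
  refine Finset.sum_bij' (fun p _ => Finset.univ.filter fun a : Fin k × W => a.2 ∈ p a.1)
    (fun I _ i => Finset.univ.filter fun w => (i, w) ∈ I) ?_ ?_ ?_ ?_ ?_
  · intro p hp
    simp only [Fintype.mem_piFinset, indepSets, Finset.mem_filter, Finset.mem_univ, true_and,
      isIndepSet_coe_iff] at hp ⊢
    rintro ⟨i, a⟩ ha ⟨j, b⟩ hb ⟨h1, h2⟩
    simp only at h1
    subst h1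
    exact hp i a ha b hb h2
  · intro I hI
    simp only [Fintype.mem_piFinset, indepSets, Finset.mem_filter, Finset.mem_univ, true_and,
      isIndepSet_coe_iff] at hI ⊢
    exact fun i a ha b hb hab => hI _ ha _ hb ⟨rfl, hab⟩
  · intro p _
    ext; simp
  · intro I _
    ext ⟨i, w⟩; simp
  · intro p _
    rw [Finset.prod_pow_eq_pow_sum]
    congr 1
    rw [← Finset.card_sigma]
    refine Finset.card_bij (fun a _ => (a.1, a.2)) ?_ ?_ ?_
    · simp
    · rintro ⟨i, a⟩ _ ⟨j, b⟩ _ h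
      simpa using h
    · rintro ⟨i, a⟩ h
      exact ⟨⟨i, a⟩, by simpa using h, rfl⟩

/-- The lines of the Fano plane that avoid the set `A` of points. -/
def avoidingLines (A : Finset (ZMod 7)) : Finset (ZMod 7) :=
  Finset.univ.filter fun l => l ∉ A ∧ l + 1 ∉ A ∧ l + 3 ∉ A

/-- How often each pair (number of points, number of avoiding lines) occurs among the `128` sets of
points. -/
theorem card_avoidingLines : (Finset.univ : Finset (Finset (ZMod 7))).val.map
    (fun A => (A.card, (avoidingLines A).card)) =
    .replicate 1 (0, 7) + .replicate 7 (1, 4) + .replicate 21 (2, 2) + .replicate 7 (3, 0) +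
    .replicate 28 (3, 1) + .replicate 7 (4, 1) + .replicate 28 (4, 0) + .replicate 21 (5, 0) +
    .replicate 7 (6, 0) + .replicate 1 (7, 0) := by
  decide +kernel

theorem indepPoly_heawood (x : ℝ) : indepPoly heawood x = heawoodPoly x := by
  classical
  have hind : ∀ A B : Finset (ZMod 7),
      heawood.IsIndepSet (A.disjSum B : Set (ZMod 7 ⊕ ZMod 7)) ↔ B ⊆ avoidingLines A := by
    intro A B
    have hsum : ∀ p : ZMod 7 ⊕ ZMod 7 → Prop, (∀ a ∈ A.disjSum B, p a) ↔
        (∀ a ∈ A, p (.inl a)) ∧ ∀ b ∈ B, p (.inr b) := by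
      simp [Sum.forall]
    rw [isIndepSet_coe_iff]
    simp only [hsum, avoidingLines, Finset.subset_iff, Finset.mem_filter,
      Finset.mem_univ, true_and]
    constructor
    · rintro ⟨h, -⟩ l hl
      refine ⟨fun h1 => ?_, fun h1 => ?_, fun h1 => ?_⟩
      · exact (h _ h1).2 l hl (.inl rfl)
      · exact (h _ h1).2 l hl (.inr (.inl rfl))
      · exact (h _ h1).2 l hl (.inr (.inr rfl))
    · intro h
      have h' : ∀ p ∈ A, ∀ l ∈ B, ¬ FanoIncident p l := by
        rintro p hp l hl (rfl | rfl | rfl)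
        exacts [(h hl).1 hp, (h hl).2.1 hp, (h hl).2.2 hp]
      exact ⟨fun p hp => ⟨fun q _ => id, fun l hl => h' p hp l hl⟩,
        fun l hl => ⟨fun p hp => h' p hp l hl, fun q _ => id⟩⟩
  rw [indepPoly, indepSets, Finset.sum_filter, ← Finset.sumEquiv.symm.toEquiv.sum_comp,
    Fintype.sum_prod_type]
  have h1 : ∀ A : Finset (ZMod 7), (∑ B : Finset (ZMod 7),
      if heawood.IsIndepSet (Finset.sumEquiv.symm.toEquiv (A, B) : Set (ZMod 7 ⊕ ZMod 7)) then
        x ^ (Finset.sumEquiv.symm.toEquiv (A, B)).card else 0) =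
      x ^ A.card * (x + 1) ^ (avoidingLines A).card := by
    intro A
    rw [← Finset.sum_pow_mul_eq_add_pow, Finset.mul_sum, ← Finset.sum_filter]
    have : (Finset.univ.filter fun B : Finset (ZMod 7) => heawood.IsIndepSet
        (Finset.sumEquiv.symm.toEquiv (A, B) : Set (ZMod 7 ⊕ ZMod 7))) =
        (avoidingLines A).powerset := by
      ext B
      rw [Finset.mem_filter, Finset.mem_powerset, ← hind]
      simp
    rw [this]
    refine Finset.sum_congr rfl fun B _ => ?_
    have : (Finset.sumEquiv.symm.toEquiv (A, B)).card = A.card + B.card :=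
      Finset.card_disjSum A B
    rw [this, pow_add, one_pow, mul_one]
  refine (Finset.sum_congr rfl fun A _ => by convert h1 A).trans ?_
  have h2 := congrArg (fun m : Multiset (ℕ × ℕ) =>
    (m.map fun c => x ^ c.1 * (x + 1) ^ c.2).sum) card_avoidingLines
  simp only [Multiset.map_map, Multiset.map_add, Multiset.map_replicate, Multiset.sum_add,
    Multiset.sum_replicate, Function.comp_def] at h2
  refine Eq.trans h2 ?_
  simp only [heawoodPoly, nsmul_eq_mul]
  push_cast
  ring

theorem hasDerivAt_heawoodPoly (x : ℝ) : ∃ d, HasDerivAt heawoodPoly d x ∧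
    x * d = 14 * heawoodOcc x := by
  refine ⟨deriv heawoodPoly x, DifferentiableAt.hasDerivAt ?_, ?_⟩
  · unfold heawoodPoly; fun_prop
  · have : HasDerivAt heawoodPoly (14 + 140 * x + 462 * x ^ 2 + 588 * x ^ 3 + 280 * x ^ 4 +
        84 * x ^ 5 + 14 * x ^ 6) x := by
      unfold heawoodPoly
      have h := fun n : ℕ => hasDerivAt_pow n x
      refine (((((((((hasDerivAt_id x).const_mul 14).const_add 1).add ((h 2).const_mul 70)).add
        ((h 3).const_mul 154)).add ((h 4).const_mul 147)).add ((h 5).const_mul 56)).add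
        ((h 6).const_mul 14)).add ((h 7).const_mul 2)).congr_deriv ?_
      norm_num
      ring
    rw [this.deriv, heawoodOcc]
    ring

end Global

/-! ### The occupancy bound and its integration -/

section Main

variable {V : Type*} [Fintype V] {G : SimpleGraph V}

theorem occupancy_lt [G.LocallyFinite] (hcubic : G.IsRegularOfDegree 3) (hgirth : 5 ≤ G.egirth)
    (hG : ¬ IsUnionOfHeawood G) {x : ℝ} (hx : 0 < x) :
    heawoodPoly x * ∑ I ∈ indepSets G, I.card * x ^ I.card <
      Fintype.card V * heawoodOcc x * indepPoly G x := by
  have B := fun v => (exists_ballLabelling hcubic hgirth v).some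
  have hn := fun v => (B v).sum_vertexSlack_nonneg hgirth hx
  have hs := sum_sum_vertexSlack hcubic x
  have h0 : 0 ≤ ∑ v, ∑ I ∈ indepSets G, x ^ I.card * vertexSlack G x v I :=
    Finset.sum_nonneg fun v _ => hn v
  rcases h0.lt_or_eq with h | h
  · rw [hs] at h
    exact sub_pos.1 (pos_of_mul_pos_right h (by positivity))
  · refine absurd (isUnionOfHeawood_of_exists_hom hcubic fun v => ?_) hG
    have hv := (Finset.sum_eq_zero_iff_of_nonneg fun v _ => hn v).1 h.symm v (Finset.mem_univ v)
    exact (B v).exists_heawood_hom hcubic hgirth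
      ((B v).rigid_of_sum_vertexSlack_eq_zero hgirth hx hv)

theorem heawoodPoly_pos {x : ℝ} (hx : 0 ≤ x) : 0 < heawoodPoly x := by
  unfold heawoodPoly
  positivity

theorem log_indepPoly_lt [G.LocallyFinite] (hcubic : G.IsRegularOfDegree 3)
    (hgirth : 5 ≤ G.egirth) (hG : ¬ IsUnionOfHeawood G) {x : ℝ} (hx : 0 < x) :
    14 * Real.log (indepPoly G x) < Fintype.card V * Real.log (indepPoly heawood x) := by
  rw [indepPoly_heawood]
  -- `F` is strictly increasing on `[0, ∞)` and vanishes at `0`, as both polynomials are `1` there.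
  let F : ℝ → ℝ := fun t =>
    Fintype.card V * Real.log (heawoodPoly t) - 14 * Real.log (indepPoly G t)
  have hder : ∀ t, 0 ≤ t → ∃ d, HasDerivAt F d t ∧ (0 < t → 0 < d) := by
    intro t ht
    obtain ⟨d, hd, hd'⟩ := hasDerivAt_heawoodPoly t
    have hG' := hasDerivAt_indepPoly G t
    have p1 := heawoodPoly_pos ht
    have p2 := indepPoly_pos G ht
    refine ⟨_, ((hd.log p1.ne').const_mul _).sub ((hG'.log p2.ne').const_mul _), fun ht' => ?_⟩
    have h1 := occupancy_lt hcubic hgirth hG ht'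
    rw [← mul_deriv_indepPoly] at h1
    rw [sub_pos, mul_div_assoc', mul_div_assoc', div_lt_div_iff₀ p2 p1]
    refine lt_of_mul_lt_mul_left ?_ ht'.le
    have e : t * (Fintype.card V * d * indepPoly G t) =
        14 * (Fintype.card V * heawoodOcc t * indepPoly G t) := by
      linear_combination (Fintype.card V * indepPoly G t) * hd'
    linarith
  have hmono : StrictMonoOn F (Set.Ici 0) := by
    refine strictMonoOn_of_deriv_pos (convex_Ici 0) ?_ ?_
    · intro t ht
      obtain ⟨d, hd, -⟩ := hder t ht
      exact hd.continuousAt.continuousWithinAt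
    · intro t ht
      rw [interior_Ici, Set.mem_Ioi] at ht
      obtain ⟨d, hd, hpos⟩ := hder t ht.le
      rw [hd.deriv]
      exact hpos ht
  have h := hmono (Set.mem_Ici.2 le_rfl) (Set.mem_Ici.2 hx.le) hx
  have h0 : F 0 = 0 := by simp [F, indepPoly_zero, heawoodPoly]
  rw [h0] at h
  exact sub_pos.1 h

theorem log_indepPoly_eq (hG : IsUnionOfHeawood G) (x : ℝ) :
    14 * Real.log (indepPoly G x) = Fintype.card V * Real.log (indepPoly heawood x) := by
  obtain ⟨k, ⟨f⟩⟩ := hG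
  have hcard : Fintype.card V = k * 14 := by
    rw [Fintype.card_congr f.toEquiv]
    simp
  rw [indepPoly_congr f, indepPoly_disjointCopies, Real.log_pow, hcard]
  push_cast
  ring

theorem log_indepPoly_le_and_eq_iff [Nonempty V] [G.LocallyFinite]
    (hcubic : G.IsRegularOfDegree 3) (hgirth : 5 ≤ G.egirth) {x : ℝ} (hx : 0 < x) :
    1 / (Fintype.card V : ℝ) * Real.log (indepPoly G x) ≤
        1 / 14 * Real.log (indepPoly heawood x) ∧
      (1 / (Fintype.card V : ℝ) * Real.log (indepPoly G x) =
          1 / 14 * Real.log (indepPoly heawood x) ↔ IsUnionOfHeawood G) := by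
  have hn : (0 : ℝ) < Fintype.card V := by exact_mod_cast Fintype.card_pos
  rw [one_div_mul_eq_div, one_div_mul_eq_div, div_le_div_iff₀ hn (by norm_num),
    div_eq_div_iff hn.ne' (by norm_num), mul_comm _ (14 : ℝ), mul_comm _ (Fintype.card V : ℝ)]
  by_cases hG : IsUnionOfHeawood G
  · have h := log_indepPoly_eq hG x
    exact ⟨h.le, iff_of_true h hG⟩
  · have h := log_indepPoly_lt hcubic hgirth hG hx
    exact ⟨h.le, iff_of_false h.ne hG⟩

end Main

theorem corollary2 {V : Type*} [Fintype V] [Nonempty V] (G : SimpleGraph V) [G.LocallyFinite]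
    (hcubic : G.IsRegularOfDegree 3) (hgirth : 5 ≤ G.egirth) :
    (∀ x : ℝ, 0 < x →
      1 / (Fintype.card V : ℝ) * Real.log (indepPoly G x) ≤
          1 / 14 * Real.log (indepPoly heawood x) ∧
        (1 / (Fintype.card V : ℝ) * Real.log (indepPoly G x) =
            1 / 14 * Real.log (indepPoly heawood x) ↔
          IsUnionOfHeawood G)) ∧
    1 / (Fintype.card V : ℝ) * Real.log ((indepSets G).card : ℝ) ≤
        1 / 14 * Real.log ((indepSets heawood).card : ℝ) ∧
    (1 / (Fintype.card V : ℝ) * Real.log ((indepSets G).card : ℝ) =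
        1 / 14 * Real.log ((indepSets heawood).card : ℝ) ↔
      IsUnionOfHeawood G) := by
  refine ⟨fun x hx => log_indepPoly_le_and_eq_iff hcubic hgirth hx, ?_⟩
  rw [← indepPoly_one, ← indepPoly_one]
  exact log_indepPoly_le_and_eq_iff hcubic hgirth one_pos
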